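/- There exist a smooth bounded toroidal domain $\Omega\subset\mathbb{R}^3$ (the image of a standard open solid torus under a smooth diffeomorphism between open subsets of $\mathbb{R}^3$ defined on a neighbourhood of the closed solid torus), a constant $P_b\in\mathbb{R}$, a vector field $u$ and a function $P$, both $C^\infty$ on an open neighbourhood of $\overline\Omega$, such that $$(\nabla\times u)\times u=\nabla P\ \text{ in }\Omega,\qquad u\cdot n=0,\quad P=P_b\ \text{ on }\partial\Omega,$$ where $n$ is the unit outward normal to $\partial\Omega$, and such that: 1. $u$ and $\nabla\times u$ are not everywhere collinear: at some point of $\Omega$ they are linearly independent. 2. No nonempty level set $\{x\in\overline\Omega: P(x)=c\}$, $c\in\mathbb{R}$, is invariant under a nontrivial continuous one-parameter group of isometries of Euclidean space. Infinitesimally, for all $a,b\in\mathbb{R}^3$ not both zero, the function $x\mapsto(a+b\times x)\cdot\nabla P(x)$ does not vanish identically in $\Omega$. 3. The solution is explicit: for some constants $r_0,\Psi_0,\varepsilon>0$ with $P_b<\Psi_0$, let $T(\Psi,\Theta,\zeta)=(x,y,z)$ be the map $$x=\bigl(r_0+\sqrt{\Psi_0-\Psi}\cos\Theta\bigr)\cos\zeta-\varepsilon\cos\zeta\bigl(1-\tfrac13\cos^2\zeta\bigr),$$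 $$y=\bigl(r_0+\sqrt{\Psi_0-\Psi}\cos\Theta\bigr)\sin\zeta-\tfrac13\varepsilon\sin^3\zeta,\qquad z=\sqrt{\Psi_0-\Psi}\,\sin\Theta .$$ Then $r_0+\sqrt{\Psi_0-\Psi}\cos\Theta-\varepsilon\sin^2\zeta>0$ for all $\Psi\in[P_b,\Psi_0]$ and $\Theta,\zeta\in\mathbb{R}$; the map $T$ is injective on $[P_b,\Psi_0)\times[0,2\pi)^2$; $\Omega=T\bigl((P_b,\Psi_0]\times\mathbb{R}^2\bigr)$; and $P=\Psi$, $u=-\partial_\Theta$ on $\overline\Omega$, that is, $P(T(\Psi,\Theta,\zeta))=\Psi$ and $u(T(\Psi,\Theta,\zeta))=-\frac{\partial T}{\partial\Theta}(\Psi,\Theta,\zeta)$ for all $\Psi\in[P_b,\Psi_0]$ and $\Theta,\zeta\in\mathbb{R}$. -/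

import Mathlib

open Real Set Filter Topology
open scoped ContDiff

/-- Euclidean three-dimensional space, with coordinates `x 0, x 1, x 2`. -/
abbrev E3 : Type := EuclideanSpace ℝ (Fin 3)

/-- The vector product `a × b` on Euclidean space. -/
def cross (a b : E3) : E3 := WithLp.toLp 2 (crossProduct a.ofLp b.ofLp)

/-- The partial derivative `∂ u_j / ∂ x_i` at `x`. -/
noncomputable def partialD (u : E3 → E3) (i j : Fin 3) (x : E3) : ℝ :=
  (fderiv ℝ u x (EuclideanSpace.single i 1)) j

/-- The curl `∇ × u`. -/
noncomputable def curl (u : E3 → E3) (x : E3) : E3 :=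
  !₂[partialD u 1 2 x - partialD u 2 1 x,
     partialD u 2 0 x - partialD u 0 2 x,
     partialD u 0 1 x - partialD u 1 0 x]

/-- The standard axially symmetric open solid torus, with major radius `2` and minor radius `1`. -/
def openSolidTorus : Set E3 :=
  {p | (√(p 0 ^ 2 + p 1 ^ 2) - 2) ^ 2 + p 2 ^ 2 < 1}

/-- The corresponding closed solid torus. -/
def closedSolidTorus : Set E3 :=
  {p | (√(p 0 ^ 2 + p 1 ^ 2) - 2) ^ 2 + p 2 ^ 2 ≤ 1}

/-- A smooth bounded toroidal volume: the image of the open solid torus under a smooth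
diffeomorphism, between open subsets of space, that is defined on a neighbourhood of the closed
solid torus. Such a set is open, bounded and connected, its closure is diffeomorphic to the closed
solid torus (as a manifold with boundary), and its boundary is a smooth embedded torus. -/
def IsToroidalDomain (Ω : Set E3) : Prop :=
  ∃ F : OpenPartialHomeomorph E3 E3,
    closedSolidTorus ⊆ F.source ∧
    ContDiffOn ℝ ∞ F F.source ∧
    ContDiffOn ℝ ∞ F.symm F.target ∧
    Ω = F '' openSolidTorus

/-- `n` is the unit outward normal to `∂Ω` at the boundary point `x`: near `x` the set `Ω` is
`{φ < 0}` for a smooth `φ` with `φ x = 0`, `∇φ x ≠ 0`, and `n = ∇φ x / |∇φ x|`. -/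
def IsOutwardUnitNormal (Ω : Set E3) (x n : E3) : Prop :=
  x ∈ frontier Ω ∧
  ∃ (φ : E3 → ℝ) (V : Set E3), IsOpen V ∧ x ∈ V ∧ ContDiffOn ℝ ∞ φ V ∧
    (∀ y ∈ V, y ∈ Ω ↔ φ y < 0) ∧ φ x = 0 ∧ gradient φ x ≠ 0 ∧
    n = ‖gradient φ x‖⁻¹ • gradient φ x

/-- `f` is smooth on the closure of `Ω`, that is, on an open set containing it. -/
def SmoothUpToBoundary {F : Type*} [NormedAddCommGroup F] [NormedSpace ℝ F]
    (Ω : Set E3) (f : E3 → F) : Prop :=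
  ∃ V : Set E3, IsOpen V ∧ closure Ω ⊆ V ∧ ContDiffOn ℝ ∞ f V

/-- `(u, P)` is a smooth solution of `(∇ × u) × u = ∇P` in `Ω`, with `u · n = 0` and `P = Pb`
on `∂Ω`. -/
structure IsSmoothSolution (Ω : Set E3) (Pb : ℝ) (u : E3 → E3) (P : E3 → ℝ) : Prop where
  smooth_u : SmoothUpToBoundary Ω u
  smooth_P : SmoothUpToBoundary Ω P
  equation : ∀ x ∈ Ω, cross (curl u x) (u x) = gradient P x
  tangential : ∀ x n : E3, IsOutwardUnitNormal Ω x n → inner ℝ (u x) n = 0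
  boundary_value : ∀ x ∈ frontier Ω, P x = Pb

/-- A nontrivial continuous one-parameter group of isometries of Euclidean space. -/
structure IsContinuousIsometryGroup (g : ℝ → (E3 ≃ᵢ E3)) : Prop where
  map_zero : ∀ x, g 0 x = x
  map_add : ∀ s t x, g (s + t) x = g s (g t x)
  continuous_orbit : ∀ x, Continuous fun t => g t x
  nontrivial : ∃ t x, g t x ≠ x

/-- The set `L` is invariant under some continuous Euclidean isometry. -/
def HasContinuousEuclideanSymmetry (L : Set E3) : Prop :=
  ∃ g : ℝ → (E3 ≃ᵢ E3), IsContinuousIsometryGroup g ∧ ∀ t, g t '' L = L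

/-- The level set `{P = c}` in the closure of `Ω`. -/
def levelSet (Ω : Set E3) (P : E3 → ℝ) (c : ℝ) : Set E3 := {x | x ∈ closure Ω ∧ P x = c}

/-- The perturbed toroidal coordinate map `(Ψ, Θ, ζ) ↦ (x, y, z)`. -/
noncomputable def toroidalMap (r₀ Ψ₀ ε : ℝ) (Ψ Θ ζ : ℝ) : E3 :=
  !₂[(r₀ + √(Ψ₀ - Ψ) * cos Θ) * cos ζ - ε * cos ζ * (1 - 1 / 3 * cos ζ ^ 2),
     (r₀ + √(Ψ₀ - Ψ) * cos Θ) * sin ζ - 1 / 3 * ε * sin ζ ^ 3,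
     √(Ψ₀ - Ψ) * sin Θ]

/-- `(u, P)` is the explicit pair `u = -∂_Θ`, `P = Ψ` of the perturbed toroidal coordinates on the
volume `Ω` enclosed by the level set `Ψ = Ψb`. On that closed volume the map has positive Jacobian
factor, and it is injective there off the axis `Ψ = Ψ₀` (where `Θ` is undetermined). -/
structure IsToroidalMapPair (r₀ Ψ₀ ε Ψb : ℝ) (Ω : Set E3) (u : E3 → E3) (P : E3 → ℝ) : Prop where
  domain : Ω = {x | ∃ Ψ ∈ Ioc Ψb Ψ₀, ∃ Θ ζ : ℝ, x = toroidalMap r₀ Ψ₀ ε Ψ Θ ζ}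
  jacobian_pos : ∀ Ψ ∈ Icc Ψb Ψ₀, ∀ Θ ζ : ℝ,
    0 < r₀ + √(Ψ₀ - Ψ) * cos Θ - ε * sin ζ ^ 2
  injective : InjOn (fun y : ℝ × ℝ × ℝ => toroidalMap r₀ Ψ₀ ε y.1 y.2.1 y.2.2)
    (Ico Ψb Ψ₀ ×ˢ (Ico 0 (2 * π) ×ˢ Ico 0 (2 * π)))
  pressure : ∀ Ψ ∈ Icc Ψb Ψ₀, ∀ Θ ζ : ℝ, P (toroidalMap r₀ Ψ₀ ε Ψ Θ ζ) = Ψ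
  velocity : ∀ Ψ ∈ Icc Ψb Ψ₀, ∀ Θ ζ : ℝ,
    u (toroidalMap r₀ Ψ₀ ε Ψ Θ ζ) = -deriv (fun θ => toroidalMap r₀ Ψ₀ ε Ψ θ ζ) Θ

/-! Let `ρ` have a horizontal gradient of unit length. For `u = z∇ρ - (ρ - 2)∇z` one gets `curl u =
2 ∇z × ∇ρ`. Since `∇ρ, ∇z` are orthonormal, `(curl u) × u = -2((ρ - 2)∇ρ + z∇z)`, the gradient of `P
= 1 - (ρ - 2)² - z²`. So any solution of the planar eikonal equation gives a solution, and it
remains to choose `ρ` without axial symmetry.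

The choice is the cylindrical radius transported by `warp`, which translates each half-plane `ζ =
const` by a vector `D(ζ)` with `D'(ζ) = -ε sin²ζ e_ζ`. As `D'` is orthogonal to `e_r`, the
transported radius still has gradient `e_r` (`inner_radialUnit_fderiv_warp`,
`hasFDerivAt_fluxRadius`). Away from the axis `warp - id` is a contraction
(`warp_sub_id_lipschitz`), hence `warp` is a diffeomorphism there.

For the absence of symmetry, the points of a pressure level set farthest from the origin are one
opposite pair on the `y`-axis, and those farthest from the `y`-axis are one opposite pair on the
`x`-axis. In a one-parameter group each element is a square, so it fixes both pairs pointwise. It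
can then only fix a point or reverse its height, and squaring once more gives the identity. -/

/-! ### Cylindrical coordinates -/

/-- Distance from the vertical axis. -/
noncomputable def cylRadius (p : E3) : ℝ := √(p 0 ^ 2 + p 1 ^ 2)

/-- The horizontal radial unit vector (zero on the vertical axis). -/
noncomputable def radialUnit (p : E3) : E3 := !₂[p 0 / cylRadius p, p 1 / cylRadius p, 0]

/-- The horizontal displacement of the perturbed coordinates with `ε = 1 / 4`. -/
noncomputable def warp (p : E3) : E3 :=
  !₂[p 0 - 1 / 4 * (radialUnit p 0 - radialUnit p 0 ^ 3 / 3),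
     p 1 - 1 / 12 * radialUnit p 1 ^ 3, p 2]

/-- Points at horizontal distance more than `1 / 2` from the vertical axis. -/
def offAxis : Set E3 := {p | 1 / 2 < cylRadius p}

/-- Cylindrical coordinates. -/
noncomputable def cylPoint (r z ζ : ℝ) : E3 := !₂[r * cos ζ, r * sin ζ, z]

lemma cylRadius_nonneg (p : E3) : 0 ≤ cylRadius p := sqrt_nonneg _

lemma cylRadius_sq (p : E3) : cylRadius p ^ 2 = p 0 ^ 2 + p 1 ^ 2 := sq_sqrt (by positivity)

@[simp] lemma radialUnit_zero (p : E3) : radialUnit p 0 = p 0 / cylRadius p := rfl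
@[simp] lemma radialUnit_one (p : E3) : radialUnit p 1 = p 1 / cylRadius p := rfl
@[simp] lemma radialUnit_two (p : E3) : radialUnit p 2 = 0 := rfl
lemma warp_zero (p : E3) :
    warp p 0 = p 0 - 1 / 4 * (radialUnit p 0 - radialUnit p 0 ^ 3 / 3) := rfl
lemma warp_one (p : E3) : warp p 1 = p 1 - 1 / 12 * radialUnit p 1 ^ 3 := rfl
@[simp] lemma warp_two (p : E3) : warp p 2 = p 2 := rfl
@[simp] lemma cylPoint_zero (r z ζ : ℝ) : cylPoint r z ζ 0 = r * cos ζ := rfl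
@[simp] lemma cylPoint_one (r z ζ : ℝ) : cylPoint r z ζ 1 = r * sin ζ := rfl
@[simp] lemma cylPoint_two (r z ζ : ℝ) : cylPoint r z ζ 2 = z := rfl

lemma E3.ext {p q : E3} (h0 : p 0 = q 0) (h1 : p 1 = q 1) (h2 : p 2 = q 2) : p = q := by
  ext i; fin_cases i <;> assumption

lemma E3.norm_sq (p : E3) : ‖p‖ ^ 2 = p 0 ^ 2 + p 1 ^ 2 + p 2 ^ 2 := by
  simp [EuclideanSpace.norm_sq_eq, Fin.sum_univ_three]

lemma E3.inner_eq (p q : E3) : inner ℝ p q = p 0 * q 0 + p 1 * q 1 + p 2 * q 2 := by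
  simp [PiLp.inner_apply, Fin.sum_univ_three, mul_comm]

lemma offAxis_pos {p : E3} (hp : p ∈ offAxis) : 0 < cylRadius p :=
  lt_trans (by norm_num) hp

lemma radialUnit_sq_add_sq {p : E3} (hp : 0 < cylRadius p) :
    radialUnit p 0 ^ 2 + radialUnit p 1 ^ 2 = 1 := by
  simp only [radialUnit_zero, radialUnit_one, div_pow, ← add_div, ← cylRadius_sq]
  exact div_self (by positivity)

lemma cylRadius_cylPoint {r : ℝ} (hr : 0 ≤ r) (z ζ : ℝ) : cylRadius (cylPoint r z ζ) = r := by
  have h : (r * cos ζ) ^ 2 + (r * sin ζ) ^ 2 = r ^ 2 := by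
    linear_combination r ^ 2 * cos_sq_add_sin_sq ζ
  simp [cylRadius, h, hr]

lemma radialUnit_cylPoint {r : ℝ} (hr : 0 < r) (z ζ : ℝ) :
    radialUnit (cylPoint r z ζ) = !₂[cos ζ, sin ζ, 0] := by
  apply E3.ext <;> simp [cylRadius_cylPoint hr.le, hr.ne']

lemma exists_polar (a b : ℝ) : ∃ θ : ℝ, a = √(a ^ 2 + b ^ 2) * cos θ ∧ b = √(a ^ 2 + b ^ 2) * sin θ := by
  have h : ‖(⟨a, b⟩ : ℂ)‖ = √(a ^ 2 + b ^ 2) := by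
    rw [Complex.norm_def, Complex.normSq_mk]; ring_nf
  refine ⟨Complex.arg ⟨a, b⟩, ?_, ?_⟩
  · rw [← h, Complex.norm_mul_cos_arg]
  · rw [← h, Complex.norm_mul_sin_arg]

lemma exists_cylPoint (p : E3) : ∃ ζ : ℝ, p = cylPoint (cylRadius p) (p 2) ζ := by
  obtain ⟨ζ, h0, h1⟩ := exists_polar (p 0) (p 1)
  exact ⟨ζ, E3.ext h0 h1 rfl⟩

lemma contDiff_coord (i : Fin 3) : ContDiff ℝ ∞ fun p : E3 => p i :=
  contDiff_euclidean.1 contDiff_id i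

lemma continuous_cylRadius : Continuous cylRadius :=
  (((contDiff_coord 0).continuous.pow 2).add ((contDiff_coord 1).continuous.pow 2)).sqrt

lemma isOpen_offAxis : IsOpen offAxis := isOpen_lt continuous_const continuous_cylRadius

lemma contDiffAt_cylRadius {p : E3} (hp : 0 < cylRadius p) : ContDiffAt ℝ ∞ cylRadius p := by
  have h : p 0 ^ 2 + p 1 ^ 2 ≠ 0 := by rw [← cylRadius_sq]; positivity
  exact (((contDiff_coord 0).pow 2).add ((contDiff_coord 1).pow 2)).contDiffAt.sqrt h

lemma contDiffAt_radialUnit {p : E3} (hp : 0 < cylRadius p) : ContDiffAt ℝ ∞ radialUnit p := by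
  refine contDiffAt_euclidean.2 fun i => ?_
  fin_cases i
  · exact (contDiff_coord 0).contDiffAt.div (contDiffAt_cylRadius hp) hp.ne'
  · exact (contDiff_coord 1).contDiffAt.div (contDiffAt_cylRadius hp) hp.ne'
  · exact contDiffAt_const

lemma contDiffAt_warp {p : E3} (hp : 0 < cylRadius p) : ContDiffAt ℝ ∞ warp p := by
  have he := contDiffAt_euclidean.1 (contDiffAt_radialUnit hp)
  refine contDiffAt_euclidean.2 fun i => ?_
  fin_cases i
  · exact (contDiff_coord 0).contDiffAt.sub
      (contDiffAt_const.mul ((he 0).sub (((he 0).pow 3).div_const 3)))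
  · exact (contDiff_coord 1).contDiffAt.sub (contDiffAt_const.mul ((he 1).pow 3))
  · exact (contDiff_coord 2).contDiffAt

/-! ### The warp as a diffeomorphism away from the axis -/

/-- In the horizontal plane the two sides differ exactly by the square of the difference of the
radii. Arguing with pairs of points avoids the mean value inequality, since `offAxis` is not convex.
-/
lemma radialUnit_dist_sq {p q : E3} (hp : 0 < cylRadius p) (hq : 0 < cylRadius q) :
    cylRadius p * cylRadius q *
      ((radialUnit p 0 - radialUnit q 0) ^ 2 + (radialUnit p 1 - radialUnit q 1) ^ 2) ≤
      (p 0 - q 0) ^ 2 + (p 1 - q 1) ^ 2 := by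
  have h1 := radialUnit_sq_add_sq hp
  have h2 := radialUnit_sq_add_sq hq
  have e : ∀ i : Fin 2, p i.castSucc = cylRadius p * radialUnit p i.castSucc ∧
      q i.castSucc = cylRadius q * radialUnit q i.castSucc := by
    intro i; fin_cases i <;> simp <;> constructor <;> field_simp
  have e0 := e 0
  have e1 := e 1
  simp only [Fin.castSucc_zero, Fin.castSucc_one] at e0 e1
  rw [e0.1, e0.2, e1.1, e1.2]
  generalize radialUnit p 0 = a at *
  generalize radialUnit p 1 = b at *
  generalize radialUnit q 0 = c at *
  generalize radialUnit q 1 = d at *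
  linear_combination sq_nonneg (cylRadius p - cylRadius q) +
    (cylRadius p * cylRadius q - cylRadius p ^ 2) * h1 +
    (cylRadius p * cylRadius q - cylRadius q ^ 2) * h2

lemma abs_cube_sub_le {a b : ℝ} (ha : a ^ 2 ≤ 1) (hb : b ^ 2 ≤ 1) :
    |a ^ 3 - b ^ 3| ≤ 3 * |a - b| := by
  rw [show a ^ 3 - b ^ 3 = (a ^ 2 + a * b + b ^ 2) * (a - b) by ring, abs_mul]
  gcongr
  rw [abs_le]
  constructor <;> nlinarith [sq_nonneg (a - b), sq_nonneg (a + b)]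

lemma abs_sub_cube_sub_le {a b : ℝ} (ha : a ^ 2 ≤ 1) (hb : b ^ 2 ≤ 1) :
    |(a - a ^ 3 / 3) - (b - b ^ 3 / 3)| ≤ |a - b| := by
  rw [show (a - a ^ 3 / 3) - (b - b ^ 3 / 3) = (1 - (a ^ 2 + a * b + b ^ 2) / 3) * (a - b) by ring,
    abs_mul]
  refine mul_le_of_le_one_left (abs_nonneg _) ?_
  rw [abs_le]
  constructor <;> nlinarith [sq_nonneg (a - b), sq_nonneg (a + b)]

/-- The displacement is `1/4`-Lipschitz in the radial unit vector, which is itself `2`-Lipschitz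
where the radius exceeds `1/2`. -/
lemma warp_sub_id_lipschitz : LipschitzOnWith (1 / 2) (fun p => warp p - p) offAxis := by
  refine LipschitzOnWith.of_dist_le_mul fun p hp q hq => ?_
  have hp0 := offAxis_pos hp
  have hq0 := offAxis_pos hq
  rw [dist_eq_norm, dist_eq_norm]
  refine abs_le_of_sq_le_sq' ?_ (by positivity) |>.2
  have h1 := radialUnit_sq_add_sq hp0
  have h2 := radialUnit_sq_add_sq hq0
  have h3 := radialUnit_dist_sq hp0 hq0
  have A : ((radialUnit p 0 - radialUnit p 0 ^ 3 / 3) -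
      (radialUnit q 0 - radialUnit q 0 ^ 3 / 3)) ^ 2 ≤ (radialUnit p 0 - radialUnit q 0) ^ 2 :=
    sq_le_sq.2 (abs_sub_cube_sub_le (by nlinarith) (by nlinarith))
  have B : (radialUnit p 1 ^ 3 - radialUnit q 1 ^ 3) ^ 2 ≤
      (3 * (radialUnit p 1 - radialUnit q 1)) ^ 2 := by
    refine sq_le_sq.2 ?_
    rw [abs_mul, abs_of_pos (three_pos : (0 : ℝ) < 3)]
    exact abs_cube_sub_le (by nlinarith) (by nlinarith)
  have C : (1 / 4 : ℝ) ≤ cylRadius p * cylRadius q := by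
    have := mul_lt_mul'' (show 1 / 2 < cylRadius p from hp) (show 1 / 2 < cylRadius q from hq)
      (by norm_num) (by norm_num)
    linarith
  have D : 1 / 4 * ((radialUnit p 0 - radialUnit q 0) ^ 2 +
      (radialUnit p 1 - radialUnit q 1) ^ 2) ≤ (p 0 - q 0) ^ 2 + (p 1 - q 1) ^ 2 :=
    le_trans (by gcongr) h3
  rw [mul_pow, E3.norm_sq, E3.norm_sq]
  simp only [PiLp.sub_apply, warp_two]
  rw [warp_zero, warp_one, warp_zero, warp_one]
  generalize radialUnit p 0 = a at *
  generalize radialUnit p 1 = b at *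
  generalize radialUnit q 0 = c at *
  generalize radialUnit q 1 = d at *
  push_cast
  nlinarith [sq_nonneg (p 2 - q 2)]

lemma warp_approximatesLinearOn :
    ApproximatesLinearOn warp (ContinuousLinearEquiv.refl ℝ E3 : E3 →L[ℝ] E3) offAxis (1 / 2) := by
  intro p hp q hq
  have h := warp_sub_id_lipschitz.dist_le_mul p hp q hq
  rw [dist_eq_norm, dist_eq_norm, sub_sub_sub_comm] at h
  exact h

/-- The restriction of `warp` to `offAxis`, as a homeomorphism onto its open image. -/
noncomputable def warpHomeo : OpenPartialHomeomorph E3 E3 :=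
  warp_approximatesLinearOn.toOpenPartialHomeomorph warp offAxis
    (Or.inr (by
      have h : ‖((ContinuousLinearEquiv.refl ℝ E3).symm : E3 →L[ℝ] E3)‖₊ = 1 :=
        NNReal.eq ContinuousLinearMap.norm_id
      rw [h, inv_one]; exact half_lt_self one_pos)) isOpen_offAxis

lemma warpHomeo_symm_mem {x : E3} (hx : x ∈ warpHomeo.target) : warpHomeo.symm x ∈ offAxis :=
  warpHomeo.map_target hx

lemma warp_symm {x : E3} (hx : x ∈ warpHomeo.target) : warp (warpHomeo.symm x) = x :=
  warpHomeo.right_inv hx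

lemma warp_mem_target {p : E3} (hp : p ∈ offAxis) : warp p ∈ warpHomeo.target :=
  warpHomeo.map_source hp

lemma symm_warp {p : E3} (hp : p ∈ offAxis) : warpHomeo.symm (warp p) = p :=
  warpHomeo.left_inv hp

/-- The derivative is within `1/2` of the identity in operator norm, so its kernel is trivial. -/
lemma hasFDerivAt_warp_equiv {p : E3} (hp : p ∈ offAxis) :
    ∃ L : E3 ≃L[ℝ] E3, HasFDerivAt warp (L : E3 →L[ℝ] E3) p := by
  have hd := ((contDiffAt_warp (offAxis_pos hp)).differentiableAt (by simp)).hasFDerivAt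
  have hle := (hd.sub (hasFDerivAt_id p)).le_of_lipschitzOn (isOpen_offAxis.mem_nhds hp)
    warp_sub_id_lipschitz
  have hinj : Function.Injective (fderiv ℝ warp p) := by
    refine (injective_iff_map_eq_zero _).2 fun v hv => ?_
    have h := (fderiv ℝ warp p - ContinuousLinearMap.id ℝ E3).le_of_opNorm_le hle v
    have h' : ‖v‖ ≤ 1 / 2 * ‖v‖ := by simpa [hv] using h
    exact norm_le_zero_iff.1 (by linarith)
  refine ⟨(LinearEquiv.ofInjectiveEndo (fderiv ℝ warp p : E3 →ₗ[ℝ] E3) hinj).toContinuousLinearEquiv,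
    ?_⟩
  exact hd

lemma contDiffAt_warp_symm {x : E3} (hx : x ∈ warpHomeo.target) :
    ContDiffAt ℝ ∞ warpHomeo.symm x := by
  obtain ⟨L, hL⟩ := hasFDerivAt_warp_equiv (warpHomeo_symm_mem hx)
  exact warpHomeo.contDiffAt_symm hx hL (contDiffAt_warp (offAxis_pos (warpHomeo_symm_mem hx)))

/-! ### The fields and the equation -/

/-- The radial coordinate before warping, as a function of the warped point. -/
noncomputable def fluxRadius (x : E3) : ℝ := cylRadius (warpHomeo.symm x)

/-- The gradient of `fluxRadius`. -/
noncomputable def fluxNormal (x : E3) : E3 := radialUnit (warpHomeo.symm x)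

noncomputable def pressureField (x : E3) : ℝ := 1 - ((fluxRadius x - 2) ^ 2 + x 2 ^ 2)

/-- With `ρ = fluxRadius` this is `z∇ρ - (ρ - 2)∇z`. -/
noncomputable def velocityField (x : E3) : E3 :=
  !₂[x 2 * fluxNormal x 0, x 2 * fluxNormal x 1, -(fluxRadius x - 2)]

@[simp] lemma fluxNormal_two (x : E3) : fluxNormal x 2 = 0 := rfl

lemma fluxNormal_sq_add_sq {x : E3} (hx : x ∈ warpHomeo.target) :
    fluxNormal x 0 ^ 2 + fluxNormal x 1 ^ 2 = 1 :=
  radialUnit_sq_add_sq (offAxis_pos (warpHomeo_symm_mem hx))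

lemma contDiffAt_fluxRadius {x : E3} (hx : x ∈ warpHomeo.target) :
    ContDiffAt ℝ ∞ fluxRadius x :=
  (contDiffAt_cylRadius (offAxis_pos (warpHomeo_symm_mem hx))).comp x (contDiffAt_warp_symm hx)

lemma contDiffAt_fluxNormal {x : E3} (hx : x ∈ warpHomeo.target) :
    ContDiffAt ℝ ∞ fluxNormal x :=
  (contDiffAt_radialUnit (offAxis_pos (warpHomeo_symm_mem hx))).comp x (contDiffAt_warp_symm hx)

lemma contDiffAt_pressureField {x : E3} (hx : x ∈ warpHomeo.target) :
    ContDiffAt ℝ ∞ pressureField x :=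
  contDiffAt_const.sub ((((contDiffAt_fluxRadius hx).sub contDiffAt_const).pow 2).add
    ((contDiff_coord 2).contDiffAt.pow 2))

lemma contDiffAt_velocityField {x : E3} (hx : x ∈ warpHomeo.target) :
    ContDiffAt ℝ ∞ velocityField x := by
  have he := contDiffAt_euclidean.1 (contDiffAt_fluxNormal hx)
  refine contDiffAt_euclidean.2 fun i => ?_
  fin_cases i
  · exact (contDiff_coord 2).contDiffAt.mul (he 0)
  · exact (contDiff_coord 2).contDiffAt.mul (he 1)
  · exact ((contDiffAt_fluxRadius hx).sub contDiffAt_const).neg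

lemma hasFDerivAt_coord (i : Fin 3) (x : E3) :
    HasFDerivAt (fun y : E3 => y i) (EuclideanSpace.proj i : E3 →L[ℝ] ℝ) x :=
  (EuclideanSpace.proj i : E3 →L[ℝ] ℝ).hasFDerivAt

lemma HasFDerivAt.coord {f : E3 → E3} {f' : E3 →L[ℝ] E3} {x : E3} (h : HasFDerivAt f f' x)
    (i : Fin 3) : HasFDerivAt (fun y => f y i) ((EuclideanSpace.proj i : E3 →L[ℝ] ℝ) ∘L f') x :=
  (hasFDerivAt_coord i (f x)).comp x h

lemma fderiv_cylRadius_apply {p : E3} (hp : 0 < cylRadius p) (v : E3) :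
    fderiv ℝ cylRadius p v = inner ℝ (radialUnit p) v := by
  have h1 := ((contDiffAt_cylRadius hp).differentiableAt (by simp)).hasFDerivAt.pow 2
  have h2 := ((hasFDerivAt_coord 0 p).pow 2).add ((hasFDerivAt_coord 1 p).pow 2)
  have h3 : (fun q => cylRadius q ^ 2) = fun q : E3 => q 0 ^ 2 + q 1 ^ 2 :=
    funext cylRadius_sq
  have h4 := congrArg (fun L : E3 →L[ℝ] ℝ => L v) ((h3 ▸ h1).unique h2)
  simp at h4
  rw [E3.inner_eq]
  simp only [radialUnit_zero, radialUnit_one, radialUnit_two]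
  field_simp
  linarith

lemma inner_radialUnit_fderiv {p : E3} (hp : 0 < cylRadius p) (v : E3) :
    inner ℝ (radialUnit p) (fderiv ℝ radialUnit p v) = 0 := by
  have h := ((contDiffAt_radialUnit hp).differentiableAt (by simp)).hasFDerivAt
  have h1 := ((h.coord 0).pow 2).add ((h.coord 1).pow 2)
  have h2 : (fun q => radialUnit q 0 ^ 2 + radialUnit q 1 ^ 2) =ᶠ[𝓝 p] fun _ => (1 : ℝ) := by
    filter_upwards [(isOpen_lt continuous_const continuous_cylRadius).mem_nhds hp] with q hq
    exact radialUnit_sq_add_sq hq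
  have h4 := congrArg (fun L : E3 →L[ℝ] ℝ => L v)
    (h1.unique ((hasFDerivAt_const (1 : ℝ) p).congr_of_eventuallyEq h2))
  simp at h4
  rw [E3.inner_eq]
  simp
  linarith

/-- For `e = (a, b)` on the unit circle, `(a - a³/3)' = (1 - a²)a' = b²a'` and `(b³/3)' = b²b'`. The
displacement therefore varies by a multiple of `e'`, which is orthogonal to `e`. The cubic terms are
chosen for this. -/
lemma inner_radialUnit_fderiv_warp {p : E3} (hp : 0 < cylRadius p) (v : E3) :
    inner ℝ (radialUnit p) (fderiv ℝ warp p v) = inner ℝ (radialUnit p) v := by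
  have he := ((contDiffAt_radialUnit hp).differentiableAt (by simp)).hasFDerivAt
  have hw := ((contDiffAt_warp hp).differentiableAt (by simp)).hasFDerivAt
  have h0 := congrArg (fun L : E3 →L[ℝ] ℝ => L v) ((hw.coord 0).unique ((hasFDerivAt_coord 0 p).sub
    (((he.coord 0).sub (((he.coord 0).pow 3).mul_const (3 : ℝ)⁻¹)).const_mul (1 / 4))))
  have h1 := congrArg (fun L : E3 →L[ℝ] ℝ => L v) ((hw.coord 1).unique ((hasFDerivAt_coord 1 p).sub
    (((he.coord 1).pow 3).const_mul (1 / 12))))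
  have h2 := radialUnit_sq_add_sq hp
  have h3 := inner_radialUnit_fderiv hp v
  rw [E3.inner_eq] at h3 ⊢
  rw [E3.inner_eq]
  simp [-radialUnit_zero, -radialUnit_one] at h0 h1 h3 ⊢
  rw [h0, h1]
  linear_combination (-1 / 4 * radialUnit p 1 ^ 2) * h3 +
    1 / 4 * radialUnit p 0 * (fderiv ℝ radialUnit p v 0) * h2

/-- The eikonal property: pairing with `e_r` is unchanged by the derivative of `warp`, hence by that
of its inverse. -/
lemma hasFDerivAt_fluxRadius {x : E3} (hx : x ∈ warpHomeo.target) :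
    HasFDerivAt fluxRadius (innerSL ℝ (fluxNormal x)) x := by
  have hp := offAxis_pos (warpHomeo_symm_mem hx)
  have hR := ((contDiffAt_cylRadius hp).differentiableAt (by simp)).hasFDerivAt
  have hw := ((contDiffAt_warp hp).differentiableAt (by simp)).hasFDerivAt
  have hs := ((contDiffAt_warp_symm hx).differentiableAt (by simp)).hasFDerivAt
  have hid := (hw.comp x hs).unique ((hasFDerivAt_id x).congr_of_eventuallyEq (by
    filter_upwards [warpHomeo.open_target.mem_nhds hx] with y hy using warp_symm hy))
  refine (hR.comp x hs).congr_fderiv (ContinuousLinearMap.ext fun v => ?_)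
  have hv := congrArg (fun L : E3 →L[ℝ] E3 => L v) hid
  simp only [ContinuousLinearMap.comp_apply, ContinuousLinearMap.id_apply] at hv
  rw [ContinuousLinearMap.comp_apply, fderiv_cylRadius_apply hp,
    ← inner_radialUnit_fderiv_warp hp]
  erw [hv]
  rfl

lemma hasGradientAt_pressureField {x : E3} (hx : x ∈ warpHomeo.target) :
    HasGradientAt pressureField (-(2 : ℝ) • !₂[(fluxRadius x - 2) * fluxNormal x 0,
      (fluxRadius x - 2) * fluxNormal x 1, x 2]) x := by
  rw [hasGradientAt_iff_hasFDerivAt]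
  have h := ((((hasFDerivAt_fluxRadius hx).sub_const 2).pow 2).add
    ((hasFDerivAt_coord 2 x).pow 2)).const_sub 1
  refine h.congr_fderiv (ContinuousLinearMap.ext fun v => ?_)
  rw [InnerProductSpace.toDual_apply_apply]
  simp [E3.inner_eq, innerSL_apply_apply]
  ring

lemma partialD_eq {u : E3 → E3} {x : E3} (hu : DifferentiableAt ℝ u x) {j : Fin 3}
    {L : E3 →L[ℝ] ℝ} (hL : HasFDerivAt (fun y => u y j) L x) (i : Fin 3) :
    partialD u i j x = L (EuclideanSpace.single i 1) :=
  congrArg (fun L : E3 →L[ℝ] ℝ => L (EuclideanSpace.single i 1)) ((hu.hasFDerivAt.coord j).unique hL)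

/-- Symmetry of the second derivative of `fluxRadius`. -/
lemma partialD_fluxNormal_comm {x : E3} (hx : x ∈ warpHomeo.target) (i j : Fin 3) :
    partialD fluxNormal i j x = partialD fluxNormal j i x := by
  have he := ((contDiffAt_fluxNormal hx).differentiableAt (by simp)).hasFDerivAt
  have h : inner ℝ (fderiv ℝ fluxNormal x (EuclideanSpace.single i 1)) (EuclideanSpace.single j 1) =
      inner ℝ (fderiv ℝ fluxNormal x (EuclideanSpace.single j 1)) (EuclideanSpace.single i 1) :=
    second_derivative_symmetric_of_eventually (𝕜 := ℝ)
    (f' := fun y => innerSL ℝ (fluxNormal y)) (Filter.eventually_of_mem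
      (warpHomeo.open_target.mem_nhds hx) fun y hy => hasFDerivAt_fluxRadius hy)
    ((innerSL ℝ : E3 →L[ℝ] E3 →L[ℝ] ℝ).hasFDerivAt.comp x he)
    (EuclideanSpace.single i 1) (EuclideanSpace.single j 1)
  simpa [partialD, EuclideanSpace.inner_single_right] using h

lemma partialD_fluxNormal_vertical {x : E3} (hx : x ∈ warpHomeo.target) (j : Fin 3) :
    partialD fluxNormal 2 j x = 0 := by
  rw [partialD_fluxNormal_comm hx,
    partialD_eq ((contDiffAt_fluxNormal hx).differentiableAt (by simp))
      (j := 2) (hasFDerivAt_const (0 : ℝ) x)]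
  rfl

lemma curl_velocityField {x : E3} (hx : x ∈ warpHomeo.target) :
    curl velocityField x = !₂[-(2 * fluxNormal x 1), 2 * fluxNormal x 0, 0] := by
  have hu := (contDiffAt_velocityField hx).differentiableAt (by simp)
  have he := ((contDiffAt_fluxNormal hx).differentiableAt (by simp)).hasFDerivAt
  have h0 := partialD_eq hu (j := 0) ((hasFDerivAt_coord 2 x).mul (he.coord 0))
  have h1 := partialD_eq hu (j := 1) ((hasFDerivAt_coord 2 x).mul (he.coord 1))
  have h2 := partialD_eq hu (j := 2) ((hasFDerivAt_fluxRadius hx).sub_const 2).neg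
  have hv0 := partialD_fluxNormal_vertical hx 0
  have hv1 := partialD_fluxNormal_vertical hx 1
  have hc := partialD_fluxNormal_comm hx 0 1
  unfold partialD at hv0 hv1 hc
  apply E3.ext <;> simp [curl, h0, h1, h2, EuclideanSpace.inner_single_right, hv0, hv1, hc] <;> ring

lemma cross_curl_velocityField {x : E3} (hx : x ∈ warpHomeo.target) :
    cross (curl velocityField x) (velocityField x) = gradient pressureField x := by
  rw [(hasGradientAt_pressureField hx).gradient, curl_velocityField hx]
  have h := fluxNormal_sq_add_sq hx
  apply E3.ext
  · simp [cross, crossProduct, velocityField]; ring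
  · simp [cross, crossProduct, velocityField]; ring
  · simp [cross, crossProduct, velocityField]; linear_combination (-2 * x 2) * h

/-! ### The toroidal domain, its boundary and its coordinates -/

/-- The perturbed toroidal map with `r₀ = 2`, `Ψ₀ = 1`, `ε = 1 / 4`. -/
noncomputable abbrev warpMap (Ψ Θ ζ : ℝ) : E3 := toroidalMap 2 1 (1 / 4) Ψ Θ ζ

/-- The unperturbed toroidal map. -/
noncomputable def torusPoint (Ψ Θ ζ : ℝ) : E3 :=
  cylPoint (2 + √(1 - Ψ) * cos Θ) (√(1 - Ψ) * sin Θ) ζ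

/-- The toroidal domain: the warped open solid torus. -/
def warpedTorus : Set E3 := warp '' openSolidTorus

lemma one_le_majorRadius {Ψ : ℝ} (hΨ : 0 ≤ Ψ) (Θ : ℝ) : 1 ≤ 2 + √(1 - Ψ) * cos Θ := by
  have h1 : √(1 - Ψ) ≤ 1 := sqrt_le_one.2 (by linarith)
  have h2 : |√(1 - Ψ) * cos Θ| ≤ 1 := by
    rw [abs_mul, abs_of_nonneg (sqrt_nonneg _)]
    exact mul_le_one₀ h1 (abs_nonneg _) (abs_cos_le_one _)
  linarith [(abs_le.1 h2).1]

lemma majorRadius_pos {Ψ : ℝ} (hΨ : 0 ≤ Ψ) (Θ : ℝ) : 0 < 2 + √(1 - Ψ) * cos Θ :=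
  one_pos.trans_le (one_le_majorRadius hΨ Θ)

lemma cylRadius_torusPoint {Ψ : ℝ} (hΨ : 0 ≤ Ψ) (Θ ζ : ℝ) :
    cylRadius (torusPoint Ψ Θ ζ) = 2 + √(1 - Ψ) * cos Θ :=
  cylRadius_cylPoint (majorRadius_pos hΨ Θ).le _ _

lemma torusPoint_mem_offAxis {Ψ : ℝ} (hΨ : 0 ≤ Ψ) (Θ ζ : ℝ) : torusPoint Ψ Θ ζ ∈ offAxis := by
  have := one_le_majorRadius hΨ Θ
  rw [offAxis, mem_ofPred_eq, cylRadius_torusPoint hΨ]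
  linarith

lemma warp_torusPoint {Ψ : ℝ} (hΨ : 0 ≤ Ψ) (Θ ζ : ℝ) :
    warp (torusPoint Ψ Θ ζ) = warpMap Ψ Θ ζ := by
  have h : radialUnit (torusPoint Ψ Θ ζ) = !₂[cos ζ, sin ζ, 0] :=
    radialUnit_cylPoint (majorRadius_pos hΨ Θ) _ _
  rw [warp, h]
  apply E3.ext
  · simp [torusPoint, toroidalMap]; ring
  · simp [torusPoint, toroidalMap]; left; ring
  · simp [torusPoint, toroidalMap]

lemma warpMap_mem_target {Ψ : ℝ} (hΨ : 0 ≤ Ψ) (Θ ζ : ℝ) :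
    warpMap Ψ Θ ζ ∈ warpHomeo.target :=
  warp_torusPoint hΨ Θ ζ ▸ warp_mem_target (torusPoint_mem_offAxis hΨ Θ ζ)

lemma symm_warpMap {Ψ : ℝ} (hΨ : 0 ≤ Ψ) (Θ ζ : ℝ) :
    warpHomeo.symm (warpMap Ψ Θ ζ) = torusPoint Ψ Θ ζ :=
  warp_torusPoint hΨ Θ ζ ▸ symm_warp (torusPoint_mem_offAxis hΨ Θ ζ)

lemma torusPoint_minorRadius {Ψ : ℝ} (hΨ : Ψ ∈ Icc (0 : ℝ) 1) (Θ ζ : ℝ) :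
    (cylRadius (torusPoint Ψ Θ ζ) - 2) ^ 2 + torusPoint Ψ Θ ζ 2 ^ 2 = 1 - Ψ := by
  have h := sq_sqrt (sub_nonneg.2 hΨ.2)
  rw [cylRadius_torusPoint hΨ.1, torusPoint, cylPoint_two]
  linear_combination (√(1 - Ψ)) ^ 2 * cos_sq_add_sin_sq Θ + h

lemma exists_torusPoint (p : E3) : ∃ Θ ζ : ℝ,
    p = torusPoint (1 - ((cylRadius p - 2) ^ 2 + p 2 ^ 2)) Θ ζ := by
  obtain ⟨ζ, hζ⟩ := exists_cylPoint p
  obtain ⟨Θ, h0, h1⟩ := exists_polar (cylRadius p - 2) (p 2)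
  refine ⟨Θ, ζ, ?_⟩
  rw [torusPoint, sub_sub_cancel, ← h0, ← h1, add_sub_cancel]
  exact hζ

lemma mem_openSolidTorus_iff {p : E3} :
    p ∈ openSolidTorus ↔ ∃ Ψ ∈ Ioc (0 : ℝ) 1, ∃ Θ ζ : ℝ, p = torusPoint Ψ Θ ζ := by
  constructor
  · intro hp
    have hp' : (cylRadius p - 2) ^ 2 + p 2 ^ 2 < 1 := hp
    exact ⟨_, ⟨by linarith, by nlinarith⟩, exists_torusPoint p⟩
  · rintro ⟨Ψ, hΨ, Θ, ζ, rfl⟩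
    have h : (cylRadius (torusPoint Ψ Θ ζ) - 2) ^ 2 + torusPoint Ψ Θ ζ 2 ^ 2 < 1 := by
      rw [torusPoint_minorRadius (Ioc_subset_Icc_self hΨ)]; linarith [hΨ.1]
    exact h

lemma mem_closedSolidTorus_iff {p : E3} :
    p ∈ closedSolidTorus ↔ ∃ Ψ ∈ Icc (0 : ℝ) 1, ∃ Θ ζ : ℝ, p = torusPoint Ψ Θ ζ := by
  constructor
  · intro hp
    have hp' : (cylRadius p - 2) ^ 2 + p 2 ^ 2 ≤ 1 := hp
    exact ⟨_, ⟨by linarith, by nlinarith⟩, exists_torusPoint p⟩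
  · rintro ⟨Ψ, hΨ, Θ, ζ, rfl⟩
    have h : (cylRadius (torusPoint Ψ Θ ζ) - 2) ^ 2 + torusPoint Ψ Θ ζ 2 ^ 2 ≤ 1 := by
      rw [torusPoint_minorRadius hΨ]; linarith [hΨ.1]
    exact h

lemma closedSolidTorus_subset_offAxis : closedSolidTorus ⊆ offAxis := by
  intro p hp
  obtain ⟨Ψ, hΨ, Θ, ζ, rfl⟩ := mem_closedSolidTorus_iff.1 hp
  exact torusPoint_mem_offAxis hΨ.1 Θ ζ

lemma openSolidTorus_subset_closedSolidTorus : openSolidTorus ⊆ closedSolidTorus :=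
  ofPred_subset_ofPred.2 fun _ hp => hp.le

lemma isOpen_openSolidTorus : IsOpen openSolidTorus :=
  isOpen_lt (((continuous_cylRadius.sub continuous_const).pow 2).add
    ((contDiff_coord 2).continuous.pow 2)) continuous_const

lemma isCompact_closedSolidTorus : IsCompact closedSolidTorus := by
  refine Metric.isCompact_of_isClosed_isBounded
    (isClosed_le (((continuous_cylRadius.sub continuous_const).pow 2).add
      ((contDiff_coord 2).continuous.pow 2)) continuous_const)
    (isBounded_iff_forall_norm_le.2 ⟨4, fun p hp => ?_⟩)
  have h : (cylRadius p - 2) ^ 2 + p 2 ^ 2 ≤ 1 := hp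
  have hn := E3.norm_sq p
  rw [← cylRadius_sq] at hn
  have h3 : cylRadius p ≤ 3 := by nlinarith [sq_nonneg (p 2)]
  nlinarith [cylRadius_nonneg p, norm_nonneg p, sq_nonneg (cylRadius p - 2)]

lemma isToroidalDomain_warpedTorus : IsToroidalDomain warpedTorus :=
  ⟨warpHomeo, closedSolidTorus_subset_offAxis,
    fun _ hp => (contDiffAt_warp (offAxis_pos hp)).contDiffWithinAt,
    fun _ hx => (contDiffAt_warp_symm hx).contDiffWithinAt, rfl⟩

lemma isOpen_warpedTorus : IsOpen warpedTorus :=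
  warpHomeo.isOpen_image_of_subset_source isOpen_openSolidTorus
    (openSolidTorus_subset_closedSolidTorus.trans closedSolidTorus_subset_offAxis)

lemma mem_warpedTorus_iff {x : E3} :
    x ∈ warpedTorus ↔ ∃ Ψ ∈ Ioc (0 : ℝ) 1, ∃ Θ ζ : ℝ, x = warpMap Ψ Θ ζ := by
  constructor
  · rintro ⟨p, hp, rfl⟩
    obtain ⟨Ψ, hΨ, Θ, ζ, rfl⟩ := mem_openSolidTorus_iff.1 hp
    exact ⟨Ψ, hΨ, Θ, ζ, warp_torusPoint hΨ.1.le Θ ζ⟩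
  · rintro ⟨Ψ, hΨ, Θ, ζ, rfl⟩
    exact ⟨_, mem_openSolidTorus_iff.2 ⟨Ψ, hΨ, Θ, ζ, rfl⟩, warp_torusPoint hΨ.1.le Θ ζ⟩

lemma continuous_warpMap (Θ ζ : ℝ) : Continuous fun Ψ => warpMap Ψ Θ ζ := by
  refine (PiLp.continuous_toLp 2 _).comp (continuous_pi fun i => ?_)
  fin_cases i <;> simp <;> fun_prop

lemma mem_closure_warpedTorus_iff {x : E3} :
    x ∈ closure warpedTorus ↔ ∃ Ψ ∈ Icc (0 : ℝ) 1, ∃ Θ ζ : ℝ, x = warpMap Ψ Θ ζ := by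
  constructor
  · intro hx
    have hc : IsCompact (warp '' closedSolidTorus) :=
      isCompact_closedSolidTorus.image_of_continuousOn
        (warpHomeo.continuousOn.mono closedSolidTorus_subset_offAxis)
    obtain ⟨p, hp, rfl⟩ := closure_minimal
      (image_mono openSolidTorus_subset_closedSolidTorus) hc.isClosed hx
    obtain ⟨Ψ, hΨ, Θ, ζ, rfl⟩ := mem_closedSolidTorus_iff.1 hp
    exact ⟨Ψ, hΨ, Θ, ζ, warp_torusPoint hΨ.1 Θ ζ⟩
  · rintro ⟨Ψ, hΨ, Θ, ζ, rfl⟩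
    -- Boundary points are limits as `Ψ` decreases to `0` at fixed angles.
    rw [← closure_Ioc zero_ne_one] at hΨ
    refine closure_mono ?_
      (image_closure_subset_closure_image (continuous_warpMap Θ ζ) (mem_image_of_mem _ hΨ))
    rintro _ ⟨Ψ', hΨ', rfl⟩
    exact mem_warpedTorus_iff.2 ⟨Ψ', hΨ', Θ, ζ, rfl⟩

lemma closure_warpedTorus_subset_target : closure warpedTorus ⊆ warpHomeo.target := by
  intro x hx
  obtain ⟨Ψ, hΨ, Θ, ζ, rfl⟩ := mem_closure_warpedTorus_iff.1 hx
  exact warpMap_mem_target hΨ.1 Θ ζ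

lemma fluxRadius_warpMap {Ψ : ℝ} (hΨ : 0 ≤ Ψ) (Θ ζ : ℝ) :
    fluxRadius (warpMap Ψ Θ ζ) = 2 + √(1 - Ψ) * cos Θ := by
  rw [fluxRadius, symm_warpMap hΨ, cylRadius_torusPoint hΨ]

lemma fluxNormal_warpMap {Ψ : ℝ} (hΨ : 0 ≤ Ψ) (Θ ζ : ℝ) :
    fluxNormal (warpMap Ψ Θ ζ) = !₂[cos ζ, sin ζ, 0] := by
  rw [fluxNormal, symm_warpMap hΨ, torusPoint, radialUnit_cylPoint (majorRadius_pos hΨ Θ)]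

lemma pressureField_warpMap {Ψ : ℝ} (hΨ : Ψ ∈ Icc (0 : ℝ) 1) (Θ ζ : ℝ) :
    pressureField (warpMap Ψ Θ ζ) = Ψ := by
  have h := torusPoint_minorRadius hΨ Θ ζ
  rw [← symm_warpMap hΨ.1] at h
  rw [pressureField, fluxRadius, ← warp_torusPoint hΨ.1, warp_two, warp_torusPoint hΨ.1,
    ← symm_warpMap hΨ.1, h, sub_sub_cancel]

lemma hasDerivAt_warpMap (Ψ Θ ζ : ℝ) : HasDerivAt (fun θ => warpMap Ψ θ ζ)
    (√(1 - Ψ) • !₂[-(sin Θ * cos ζ), -(sin Θ * sin ζ), cos Θ]) Θ := by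
  -- At fixed `ζ` the curve is a circle of radius `√(1 - Ψ)` about the axis point `warpMap 1 0 ζ`.
  have h : (fun θ => warpMap Ψ θ ζ) = fun θ => warpMap 1 0 ζ +
      (cos θ • (√(1 - Ψ) • (!₂[cos ζ, sin ζ, 0] : E3)) + sin θ • (√(1 - Ψ) • (!₂[0, 0, 1] : E3))) := by
    ext1 θ
    apply E3.ext <;> simp [toroidalMap] <;> ring
  rw [h]
  refine (((hasDerivAt_cos Θ).smul_const _).add ((hasDerivAt_sin Θ).smul_const _)).const_add _
    |>.congr_deriv ?_
  apply E3.ext <;> simp <;> ring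

lemma velocityField_warpMap {Ψ : ℝ} (hΨ : 0 ≤ Ψ) (Θ ζ : ℝ) :
    velocityField (warpMap Ψ Θ ζ) = -deriv (fun θ => warpMap Ψ θ ζ) Θ := by
  rw [(hasDerivAt_warpMap Ψ Θ ζ).deriv, velocityField, fluxNormal_warpMap hΨ,
    fluxRadius_warpMap hΨ]
  apply E3.ext <;> simp [toroidalMap] <;> ring

lemma mem_frontier_warpedTorus {x : E3} (hx : x ∈ frontier warpedTorus) :
    ∃ Θ ζ : ℝ, x = warpMap 0 Θ ζ := by
  rw [isOpen_warpedTorus.frontier_eq] at hx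
  obtain ⟨Ψ, hΨ, Θ, ζ, rfl⟩ := mem_closure_warpedTorus_iff.1 hx.1
  rcases hΨ.1.eq_or_lt with rfl | h
  · exact ⟨Θ, ζ, rfl⟩
  · exact (hx.2 (mem_warpedTorus_iff.2 ⟨Ψ, ⟨h, hΨ.2⟩, Θ, ζ, rfl⟩)).elim

lemma warpMap_zero_notMem (Θ ζ : ℝ) : warpMap 0 Θ ζ ∉ warpedTorus := by
  intro h
  obtain ⟨Ψ, hΨ, Θ', ζ', h⟩ := mem_warpedTorus_iff.1 h
  have h1 := congrArg pressureField h
  rw [pressureField_warpMap (by simp), pressureField_warpMap (Ioc_subset_Icc_self hΨ)] at h1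
  exact hΨ.1.ne h1

lemma velocityField_tangential {x n : E3} (hn : IsOutwardUnitNormal warpedTorus x n) :
    inner ℝ (velocityField x) n = 0 := by
  obtain ⟨hx, φ, V, hV, hxV, hφ, hiff, hφx, -, rfl⟩ := hn
  obtain ⟨Θ, ζ, rfl⟩ := mem_frontier_warpedTorus hx
  have hc := (hasDerivAt_warpMap 0 Θ ζ).differentiableAt.hasDerivAt
  have hd : HasFDerivAt φ _ (warpMap 0 Θ ζ) :=
    ((hφ.contDiffAt (hV.mem_nhds hxV)).differentiableAt (by simp)).hasGradientAt.hasFDerivAt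
  -- The boundary circle through `x` never enters the domain, so `φ ≥ 0` along it near `x`, with
  -- value `0` at `x`.
  have hmin : IsLocalMin (fun θ => φ (warpMap 0 θ ζ)) Θ := by
    filter_upwards [hc.continuousAt.preimage_mem_nhds (hV.mem_nhds hxV)] with θ hθ
    simp only [hφx]
    exact not_lt.1 fun h => warpMap_zero_notMem θ ζ ((hiff _ hθ).2 h)
  have h0 := hmin.hasDerivAt_eq_zero (hd.comp_hasDerivAt Θ hc)
  rw [InnerProductSpace.toDual_apply_apply] at h0
  rw [velocityField_warpMap le_rfl, inner_smul_right, inner_neg_left, real_inner_comm, h0]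
  simp

lemma isSmoothSolution_warpedTorus :
    IsSmoothSolution warpedTorus 0 velocityField pressureField where
  smooth_u := ⟨_, warpHomeo.open_target, closure_warpedTorus_subset_target,
    fun _ hx => (contDiffAt_velocityField hx).contDiffWithinAt⟩
  smooth_P := ⟨_, warpHomeo.open_target, closure_warpedTorus_subset_target,
    fun _ hx => (contDiffAt_pressureField hx).contDiffWithinAt⟩
  equation _ hx :=
    cross_curl_velocityField (closure_warpedTorus_subset_target (subset_closure hx))
  tangential _ _ hn := velocityField_tangential hn
  boundary_value x hx := by
    obtain ⟨Θ, ζ, rfl⟩ := mem_frontier_warpedTorus hx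
    exact pressureField_warpMap (by simp) Θ ζ

lemma eq_of_cos_eq_of_sin_eq {a b : ℝ} (ha : a ∈ Ico 0 (2 * π)) (hb : b ∈ Ico 0 (2 * π))
    (hc : cos a = cos b) (hs : sin a = sin b) : a = b := by
  have h : cos (a - b) = 1 := by
    rw [cos_sub, hc, hs, ← sq, ← sq, cos_sq_add_sin_sq]
  exact sub_eq_zero.1 ((cos_eq_one_iff_of_lt_of_lt (by linarith [ha.1, hb.2])
    (by linarith [ha.2, hb.1])).1 h)

lemma eq_of_polar_eq {r s a b : ℝ} (hr : 0 < r) (hs : 0 < s) (ha : a ∈ Ico 0 (2 * π))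
    (hb : b ∈ Ico 0 (2 * π)) (h0 : r * cos a = s * cos b) (h1 : r * sin a = s * sin b) :
    r = s ∧ a = b := by
  have h : r = s := by
    refine (sq_eq_sq₀ hr.le hs.le).1 ?_
    linear_combination (r * cos a + s * cos b) * h0 + (r * sin a + s * sin b) * h1 -
      r ^ 2 * cos_sq_add_sin_sq a + s ^ 2 * cos_sq_add_sin_sq b
  subst h
  exact ⟨rfl, eq_of_cos_eq_of_sin_eq ha hb (mul_left_cancel₀ hr.ne' h0)
    (mul_left_cancel₀ hr.ne' h1)⟩

lemma warpMap_injOn : InjOn (fun y : ℝ × ℝ × ℝ => warpMap y.1 y.2.1 y.2.2)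
    (Ico 0 1 ×ˢ (Ico 0 (2 * π) ×ˢ Ico 0 (2 * π))) := by
  rintro ⟨Ψ, Θ, ζ⟩ ⟨hΨ, hΘ, hζ⟩ ⟨Ψ', Θ', ζ'⟩ ⟨hΨ', hΘ', hζ'⟩ h
  simp only at h hΨ hΘ hζ hΨ' hΘ' hζ'
  have hp := congrArg warpHomeo.symm h
  rw [symm_warpMap hΨ.1, symm_warpMap hΨ'.1] at hp
  have c0 := congrArg (fun p : E3 => p 0) hp
  have c1 := congrArg (fun p : E3 => p 1) hp
  have c2 := congrArg (fun p : E3 => p 2) hp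
  simp only [torusPoint, cylPoint_zero, cylPoint_one, cylPoint_two] at c0 c1 c2
  obtain ⟨hr, rfl⟩ := eq_of_polar_eq (majorRadius_pos hΨ.1 Θ) (majorRadius_pos hΨ'.1 Θ') hζ hζ' c0 c1
  obtain ⟨hs, rfl⟩ := eq_of_polar_eq (sqrt_pos.2 (sub_pos.2 hΨ.2)) (sqrt_pos.2 (sub_pos.2 hΨ'.2))
    hΘ hΘ' (add_left_cancel hr) c2
  have := (sqrt_inj (sub_nonneg.2 hΨ.2.le) (sub_nonneg.2 hΨ'.2.le)).1 hs
  rw [sub_right_inj.1 this]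

lemma isToroidalMapPair_warpedTorus :
    IsToroidalMapPair 2 1 (1 / 4) 0 warpedTorus velocityField pressureField where
  domain := Set.ext fun _ => mem_warpedTorus_iff
  jacobian_pos Ψ hΨ Θ ζ := by linarith [one_le_majorRadius hΨ.1 Θ, sin_sq_le_one ζ]
  injective := warpMap_injOn
  pressure _ hΨ := pressureField_warpMap hΨ
  velocity _ hΨ := velocityField_warpMap hΨ.1

/-! ### Non-collinearity and infinitesimal asymmetry -/

lemma exists_linearIndependent_curl :
    ∃ x ∈ warpedTorus, LinearIndependent ℝ ![curl velocityField x, velocityField x] := by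
  have h0 : (0 : ℝ) ≤ 3 / 4 := by norm_num
  refine ⟨warpMap (3 / 4) 0 0, mem_warpedTorus_iff.2 ⟨3 / 4, by norm_num, 0, 0, rfl⟩, ?_⟩
  rw [curl_velocityField (warpMap_mem_target h0 0 0), velocityField_warpMap h0,
    (hasDerivAt_warpMap _ _ _).deriv, fluxNormal_warpMap h0, LinearIndependent.pair_iff]
  intro s t h
  have h1 := congrArg (fun p : E3 => p 1) h
  have h2 := congrArg (fun p : E3 => p 2) h
  have h3 : √(1 - 3 / 4 : ℝ) ≠ 0 := (sqrt_pos.2 (by norm_num)).ne'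
  simp at h1 h2
  exact ⟨h1, h2.resolve_right h3⟩

lemma inner_killing_gradient {Ψ : ℝ} (hΨ : 0 ≤ Ψ) (Θ ζ : ℝ) (a b : E3) :
    inner ℝ (a + cross b (warpMap Ψ Θ ζ)) (gradient pressureField (warpMap Ψ Θ ζ)) =
      -(2 * √(1 - Ψ)) * (cos Θ * ((a 0 + (b 1 * warpMap Ψ Θ ζ 2 - b 2 * warpMap Ψ Θ ζ 1)) * cos ζ +
        (a 1 + (b 2 * warpMap Ψ Θ ζ 0 - b 0 * warpMap Ψ Θ ζ 2)) * sin ζ) +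
        sin Θ * (a 2 + (b 0 * warpMap Ψ Θ ζ 1 - b 1 * warpMap Ψ Θ ζ 0))) := by
  rw [(hasGradientAt_pressureField (warpMap_mem_target hΨ Θ ζ)).gradient, fluxNormal_warpMap hΨ,
    fluxRadius_warpMap hΨ, E3.inner_eq]
  have h2 : warpMap Ψ Θ ζ 2 = √(1 - Ψ) * sin Θ := rfl
  simp [cross, crossProduct]
  rw [h2]
  ring

lemma exists_inner_killing_gradient_ne_zero {a b : E3} (hab : a ≠ 0 ∨ b ≠ 0) :
    ∃ x ∈ warpedTorus, inner ℝ (a + cross b x) (gradient pressureField x) ≠ 0 := by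
  by_contra! H
  have h0 : (0 : ℝ) ≤ 3 / 4 := by norm_num
  have h3 : √(1 - 3 / 4 : ℝ) = 1 / 2 := by
    rw [show (1 - 3 / 4 : ℝ) = (1 / 2) ^ 2 by norm_num, sqrt_sq (by norm_num)]
  have K : ∀ Θ ζ : ℝ, _ = (0 : ℝ) := fun Θ ζ => (inner_killing_gradient h0 Θ ζ a b).symm.trans
    (H _ (mem_warpedTorus_iff.2 ⟨3 / 4, by norm_num, Θ, ζ, rfl⟩))
  -- At `Θ = π/2` only the vertical component of the Killing field is tested, at `Θ = 0` only the
  -- one along `e_r`.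
  have k1 := K (π / 2) 0
  have k2 := K (π / 2) π
  have k3 := K (π / 2) (π / 2)
  have k4 := K 0 0
  have k5 := K 0 (π / 2)
  have k6 := K 0 (π / 4)
  simp only [toroidalMap, h3, PiLp.toLp_apply, Matrix.cons_val_zero, Matrix.cons_val_one,
    Matrix.cons_val, cos_pi_div_two, sin_pi_div_two, cos_zero, sin_zero, cos_pi, sin_pi,
    cos_pi_div_four, sin_pi_div_four] at k1 k2 k3 k4 k5 k6
  have hs : (√2 : ℝ) ^ 2 = 2 := by norm_num
  have b1 : b 1 = 0 := by linarith
  have a2 : a 2 = 0 := by rw [b1] at k1; linarith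
  have b0 : b 0 = 0 := by rw [a2] at k3; linarith
  have a0 : a 0 = 0 := by rw [b1] at k4; linarith
  have a1 : a 1 = 0 := by rw [b0] at k5; linarith
  rw [a0, a1, a2, b0, b1] at k6
  -- Only here does the perturbation matter: the point with `Θ = 0`, `ζ = π/4` has `x ≠ y`, so
  -- rotation about the `z`-axis is excluded.
  have b2 : b 2 = 0 := by
    ring_nf at k6
    rw [show √2 ^ 4 = (√2 ^ 2) ^ 2 by ring, hs] at k6
    linarith
  exact hab.elim (fun h => h (E3.ext a0 a1 a2)) (fun h => h (E3.ext b0 b1 b2))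

/-! ### Rigidity of the level sets -/

lemma apply_apply_eq_of_mapsTo_pair {α : Type*} {f : α → α} (hf : Function.Injective f) {a b : α}
    (ha : f a = a ∨ f a = b) (hb : f b = a ∨ f b = b) : f (f a) = a ∧ f (f b) = b := by
  grind [Function.Injective]

/-- The squared norm is its maximum minus a deficit, arranged as a `Θ`-term and a `ζ`-term that are
both nonnegative when `0 ≤ Ψ`. -/
lemma norm_sq_warpMap {Ψ Θ ζ : ℝ} : ‖warpMap Ψ Θ ζ‖ ^ 2 =
    (2 + √(1 - Ψ) - 1 / 12) ^ 2 - (√(1 - Ψ) * (1 - cos Θ) * (4 - 1 / 6) + cos ζ ^ 2 *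
      (1 / 6 * (2 + √(1 - Ψ) * cos Θ) - 1 / 144 * (6 - 3 * cos ζ ^ 2))) := by
  rw [E3.norm_sq]
  have h1 := sin_sq Θ
  have h2 := sin_sq ζ
  simp only [toroidalMap, PiLp.toLp_apply, Matrix.cons_val_zero, Matrix.cons_val_one,
    Matrix.cons_val]
  have h4 : sin ζ ^ 4 = (1 - cos ζ ^ 2) ^ 2 := by rw [← h2]; ring
  have h6 : sin ζ ^ 6 = (1 - cos ζ ^ 2) ^ 3 := by rw [← h2]; ring
  ring_nf
  rw [h1, h2, h4, h6]
  ring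

/-- The points of a flux surface farthest from the origin. -/
noncomputable def farPoint (s : ℝ) : E3 := !₂[0, 2 + s - 1 / 12, 0]

/-- The points of a flux surface farthest from the second coordinate axis. -/
noncomputable def sidePoint (s : ℝ) : E3 := !₂[2 + s - 1 / 6, 0, 0]

lemma warpMap_eq_farPoint {Ψ : ℝ} (Θ ζ : ℝ) (hΨ : 0 ≤ Ψ)
    (h : 2 + √(1 - Ψ) - 1 / 12 ≤ ‖warpMap Ψ Θ ζ‖) :
    warpMap Ψ Θ ζ = farPoint √(1 - Ψ) ∨ warpMap Ψ Θ ζ = -farPoint √(1 - Ψ) := by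
  have hs := sqrt_nonneg (1 - Ψ)
  have h1 := one_le_majorRadius hΨ Θ
  have hsq := pow_le_pow_left₀ (by linarith) h 2
  rw [norm_sq_warpMap] at hsq
  have hA : 0 ≤ √(1 - Ψ) * (1 - cos Θ) := mul_nonneg hs (by linarith [cos_le_one Θ])
  -- The major radius is at least `1`, and `1/6 - 6/144 = 1/8`.
  have hB : 1 / 8 * cos ζ ^ 2 ≤ cos ζ ^ 2 *
      (1 / 6 * (2 + √(1 - Ψ) * cos Θ) - 1 / 144 * (6 - 3 * cos ζ ^ 2)) := by
    rw [mul_comm]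
    gcongr
    nlinarith [sq_nonneg (cos ζ)]
  have hc : cos ζ = 0 := by
    have : cos ζ ^ 2 = 0 := le_antisymm (by linarith) (sq_nonneg _)
    exact pow_eq_zero_iff two_ne_zero |>.1 this
  have hA0 : √(1 - Ψ) * cos Θ = √(1 - Ψ) := by
    have := sq_nonneg (cos ζ); linarith
  have hz : √(1 - Ψ) * sin Θ = 0 := by
    refine pow_eq_zero_iff two_ne_zero |>.1 ?_
    linear_combination (√(1 - Ψ)) ^ 2 * sin_sq_add_cos_sq Θ -
      (√(1 - Ψ) * cos Θ + √(1 - Ψ)) * hA0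
  have hsin : sin ζ = 1 ∨ sin ζ = -1 := by
    have := sin_sq_add_cos_sq ζ
    rw [hc] at this
    exact sq_eq_one_iff.1 (by linear_combination this)
  rcases hsin with hsin | hsin
  · left
    apply E3.ext <;> simp [toroidalMap, farPoint, hc, hA0, hz, hsin]; ring
  · right
    apply E3.ext <;> simp [toroidalMap, farPoint, hc, hA0, hz, hsin]; ring

lemma norm_warpMap_le {Ψ : ℝ} (Θ ζ : ℝ) (hΨ : 0 ≤ Ψ) :
    ‖warpMap Ψ Θ ζ‖ ≤ 2 + √(1 - Ψ) - 1 / 12 := by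
  have hs := sqrt_nonneg (1 - Ψ)
  have h1 := one_le_majorRadius hΨ Θ
  refine le_of_sq_le_sq ?_ (by linarith)
  rw [norm_sq_warpMap]
  have hA : 0 ≤ √(1 - Ψ) * (1 - cos Θ) := mul_nonneg hs (by linarith [cos_le_one Θ])
  have hB : 0 ≤ cos ζ ^ 2 *
      (1 / 6 * (2 + √(1 - Ψ) * cos Θ) - 1 / 144 * (6 - 3 * cos ζ ^ 2)) := by
    refine mul_nonneg (sq_nonneg _) ?_
    nlinarith [sq_nonneg (cos ζ)]
  linarith

/-- The prescribed value is the maximal squared distance from the `y`-axis. Attaining it forces both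
nonnegative deficits in `key` to vanish, so `cos²ζ = 1` and the point is outermost in its
cross-section. -/
lemma warpMap_eq_sidePoint {Ψ : ℝ} (Θ ζ : ℝ) (hΨ : 0 ≤ Ψ)
    (h : warpMap Ψ Θ ζ 0 ^ 2 + warpMap Ψ Θ ζ 2 ^ 2 = (2 + √(1 - Ψ) - 1 / 6) ^ 2) :
    warpMap Ψ Θ ζ = sidePoint √(1 - Ψ) ∨ warpMap Ψ Θ ζ = -sidePoint √(1 - Ψ) := by
  have hs := sqrt_nonneg (1 - Ψ)
  have h1 := one_le_majorRadius hΨ Θ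
  have e0 : warpMap Ψ Θ ζ 0 =
      cos ζ * (2 + √(1 - Ψ) * cos Θ - 1 / 6 - 1 / 12 * (1 - cos ζ ^ 2)) := by
    simp [toroidalMap]; ring
  have e2 : warpMap Ψ Θ ζ 2 = √(1 - Ψ) * sin Θ := rfl
  rw [e0, e2] at h
  have hk := cos_sq_le_one ζ
  have hA : 0 ≤ √(1 - Ψ) * (1 - cos Θ) := mul_nonneg hs (by linarith [cos_le_one Θ])
  have hW : (2 + √(1 - Ψ) * cos Θ - 1 / 6 - 1 / 12 * (1 - cos ζ ^ 2)) ^ 2 ≤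
      (2 + √(1 - Ψ) * cos Θ - 1 / 6) ^ 2 := by
    refine pow_le_pow_left₀ ?_ (by linarith) 2
    nlinarith [sq_nonneg (cos ζ)]
  have hX : cos ζ ^ 2 * (2 + √(1 - Ψ) * cos Θ - 1 / 6 - 1 / 12 * (1 - cos ζ ^ 2)) ^ 2 ≤
      cos ζ ^ 2 * (2 + √(1 - Ψ) * cos Θ - 1 / 6) ^ 2 := by gcongr
  have hW1 : 1 / 4 ≤ (2 + √(1 - Ψ) * cos Θ - 1 / 6) ^ 2 := by nlinarith
  have hY : (1 - cos ζ ^ 2) * (1 / 4) ≤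
      (1 - cos ζ ^ 2) * (2 + √(1 - Ψ) * cos Θ - 1 / 6) ^ 2 := by
    gcongr
  have key : (1 - cos ζ ^ 2) * (1 / 4) + 2 * (2 - 1 / 6) * (√(1 - Ψ) * (1 - cos Θ)) ≤ 0 := by
    linear_combination hX + hY - h + (√(1 - Ψ)) ^ 2 * sin_sq_add_cos_sq Θ
  have hc : cos ζ ^ 2 = 1 := le_antisymm hk (by linarith)
  have hA0 : √(1 - Ψ) * cos Θ = √(1 - Ψ) := by linarith
  have hz : √(1 - Ψ) * sin Θ = 0 := by
    refine pow_eq_zero_iff two_ne_zero |>.1 ?_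
    linear_combination (√(1 - Ψ)) ^ 2 * sin_sq_add_cos_sq Θ -
      (√(1 - Ψ) * cos Θ + √(1 - Ψ)) * hA0
  have hsin : sin ζ = 0 := by
    refine pow_eq_zero_iff two_ne_zero |>.1 ?_
    linear_combination sin_sq_add_cos_sq ζ - hc
  rcases sq_eq_one_iff.1 hc with hc | hc
  · left
    apply E3.ext <;> simp [toroidalMap, sidePoint, hc, hA0, hz, hsin]; ring
  · right
    apply E3.ext <;> simp [toroidalMap, sidePoint, hc, hA0, hz, hsin]; ring

lemma mem_levelSet_iff {Ψ : ℝ} {x : E3} : x ∈ levelSet warpedTorus pressureField Ψ ↔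
    Ψ ∈ Icc (0 : ℝ) 1 ∧ ∃ Θ ζ : ℝ, x = warpMap Ψ Θ ζ := by
  constructor
  · rintro ⟨hx, hP⟩
    obtain ⟨Ψ', hΨ', Θ, ζ, rfl⟩ := mem_closure_warpedTorus_iff.1 hx
    rw [pressureField_warpMap hΨ'] at hP
    exact hP ▸ ⟨hΨ', Θ, ζ, rfl⟩
  · rintro ⟨hΨ, Θ, ζ, rfl⟩
    exact ⟨mem_closure_warpedTorus_iff.2 ⟨Ψ, hΨ, Θ, ζ, rfl⟩, pressureField_warpMap hΨ Θ ζ⟩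

lemma farPoint_eq (Ψ : ℝ) : farPoint √(1 - Ψ) = warpMap Ψ 0 (π / 2) := by
  apply E3.ext <;> simp [toroidalMap, farPoint]; ring

lemma neg_farPoint_eq (Ψ : ℝ) : -farPoint √(1 - Ψ) = warpMap Ψ 0 (-(π / 2)) := by
  apply E3.ext <;> simp [toroidalMap, farPoint]; ring

lemma sidePoint_eq (Ψ : ℝ) : sidePoint √(1 - Ψ) = warpMap Ψ 0 0 := by
  apply E3.ext <;> simp [toroidalMap, sidePoint]; ring

lemma neg_sidePoint_eq (Ψ : ℝ) : -sidePoint √(1 - Ψ) = warpMap Ψ 0 π := by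
  apply E3.ext <;> simp [toroidalMap, sidePoint]; ring

lemma norm_farPoint {s : ℝ} (hs : 0 ≤ s) : ‖farPoint s‖ = 2 + s - 1 / 12 := by
  refine (sq_eq_sq₀ (norm_nonneg _) (by linarith)).1 ?_
  rw [E3.norm_sq]
  simp [farPoint]

lemma dist_sq_eq (p q : E3) :
    dist p q ^ 2 = (p 0 - q 0) ^ 2 + (p 1 - q 1) ^ 2 + (p 2 - q 2) ^ 2 := by
  rw [dist_eq_norm, E3.norm_sq]; rfl

/-- An isometry preserving a flux surface permutes its two points farthest apart. -/
lemma isometry_farPoint {Ψ : ℝ} (hΨ : Ψ ∈ Icc (0 : ℝ) 1) (g : E3 ≃ᵢ E3)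
    (hg : g '' levelSet warpedTorus pressureField Ψ = levelSet warpedTorus pressureField Ψ) :
    (g (farPoint √(1 - Ψ)) = farPoint √(1 - Ψ) ∨ g (farPoint √(1 - Ψ)) = -farPoint √(1 - Ψ)) ∧
    (g (-farPoint √(1 - Ψ)) = farPoint √(1 - Ψ) ∨
      g (-farPoint √(1 - Ψ)) = -farPoint √(1 - Ψ)) := by
  have hs := sqrt_nonneg (1 - Ψ)
  obtain ⟨-, Θ, ζ, h⟩ := mem_levelSet_iff.1
    (hg.subset (mem_image_of_mem g (mem_levelSet_iff.2 ⟨hΨ, _, _, farPoint_eq Ψ⟩)))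
  obtain ⟨-, Θ', ζ', h'⟩ := mem_levelSet_iff.1
    (hg.subset (mem_image_of_mem g (mem_levelSet_iff.2 ⟨hΨ, _, _, neg_farPoint_eq Ψ⟩)))
  have hd : dist (g (farPoint √(1 - Ψ))) (g (-farPoint √(1 - Ψ))) = 2 * (2 + √(1 - Ψ) - 1 / 12) := by
    rw [g.dist_eq, dist_eq_norm, sub_neg_eq_add, ← two_smul ℝ, norm_smul, norm_farPoint hs]
    simp
  -- The images are twice the maximal norm apart, so each of them has maximal norm.
  have hle := dist_le_norm_add_norm (g (farPoint √(1 - Ψ))) (g (-farPoint √(1 - Ψ)))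
  rw [hd, h, h'] at hle
  rw [h, h']
  exact ⟨warpMap_eq_farPoint _ _ hΨ.1 (by linarith [norm_warpMap_le Θ' ζ' hΨ.1]),
    warpMap_eq_farPoint _ _ hΨ.1 (by linarith [norm_warpMap_le Θ ζ hΨ.1])⟩

/-- An isometry fixing a pair of opposite points preserves the coordinate along their line and
the norm. -/
lemma coord_eq_of_fix_farPoint {s : ℝ} (hs : 0 ≤ s) (g : E3 ≃ᵢ E3) (h : g (farPoint s) = farPoint s)
    (h' : g (-farPoint s) = -farPoint s) (p : E3) :
    g p 1 = p 1 ∧ g p 0 ^ 2 + g p 2 ^ 2 = p 0 ^ 2 + p 2 ^ 2 := by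
  have e := congrArg (· ^ 2) (g.dist_eq p (farPoint s))
  have e' := congrArg (· ^ 2) (g.dist_eq p (-farPoint s))
  simp only [h, h', dist_sq_eq] at e e'
  simp [farPoint] at e e'
  have h1 : g p 1 = p 1 := by
    have h4 : (2 + s - 1 / 12) * (g p 1 - p 1) = 0 := by
      linear_combination (e' - e) / 4
    rcases mul_eq_zero.1 h4 with h4 | h4 <;> linarith
  refine ⟨h1, ?_⟩
  rw [h1] at e
  linarith

lemma isometry_sidePoint {Ψ : ℝ} (hΨ : Ψ ∈ Icc (0 : ℝ) 1) (g : E3 ≃ᵢ E3)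
    (hg : g '' levelSet warpedTorus pressureField Ψ = levelSet warpedTorus pressureField Ψ)
    (hfix : ∀ p : E3, g p 0 ^ 2 + g p 2 ^ 2 = p 0 ^ 2 + p 2 ^ 2) :
    (g (sidePoint √(1 - Ψ)) = sidePoint √(1 - Ψ) ∨
      g (sidePoint √(1 - Ψ)) = -sidePoint √(1 - Ψ)) ∧
    (g (-sidePoint √(1 - Ψ)) = sidePoint √(1 - Ψ) ∨
      g (-sidePoint √(1 - Ψ)) = -sidePoint √(1 - Ψ)) := by
  obtain ⟨-, Θ, ζ, h⟩ := mem_levelSet_iff.1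
    (hg.subset (mem_image_of_mem g (mem_levelSet_iff.2 ⟨hΨ, _, _, sidePoint_eq Ψ⟩)))
  obtain ⟨-, Θ', ζ', h'⟩ := mem_levelSet_iff.1
    (hg.subset (mem_image_of_mem g (mem_levelSet_iff.2 ⟨hΨ, _, _, neg_sidePoint_eq Ψ⟩)))
  have e := hfix (sidePoint √(1 - Ψ))
  have e' := hfix (-sidePoint √(1 - Ψ))
  rw [h] at e ⊢
  rw [h'] at e' ⊢
  exact ⟨warpMap_eq_sidePoint _ _ hΨ.1 (e.trans (by simp [sidePoint])),
    warpMap_eq_sidePoint _ _ hΨ.1 (e'.trans (by simp [sidePoint]; ring))⟩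

lemma not_hasContinuousEuclideanSymmetry_levelSet (c : ℝ)
    (hc : (levelSet warpedTorus pressureField c).Nonempty) :
    ¬ HasContinuousEuclideanSymmetry (levelSet warpedTorus pressureField c) := by
  rintro ⟨g, hg, hinv⟩
  obtain ⟨x, hx⟩ := hc
  have hΨ := (mem_levelSet_iff.1 hx).1
  have hs := sqrt_nonneg (1 - c)
  -- Each group element is a square, so a pair permuted by every element is fixed pointwise.
  have half : ∀ t p, g t p = g (t / 2) (g (t / 2) p) := fun t p => by
    rw [← hg.map_add, add_halves]
  have hfar : ∀ t, g t (farPoint √(1 - c)) = farPoint √(1 - c) ∧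
      g t (-farPoint √(1 - c)) = -farPoint √(1 - c) := fun t => by
    have h := isometry_farPoint hΨ (g (t / 2)) (hinv _)
    rw [half t, half t]
    exact apply_apply_eq_of_mapsTo_pair (g (t / 2)).injective h.1 h.2
  have hco := fun t => coord_eq_of_fix_farPoint hs (g t) (hfar t).1 (hfar t).2
  have hside : ∀ t, g t (sidePoint √(1 - c)) = sidePoint √(1 - c) := fun t => by
    have h := isometry_sidePoint hΨ (g (t / 2)) (hinv _) fun p => (hco _ p).2
    rw [half]
    exact (apply_apply_eq_of_mapsTo_pair (g (t / 2)).injective h.1 h.2).1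
  -- With `y` and `x² + z²` preserved, the distance to `sidePoint` determines `x`, leaving only the
  -- sign of `z`.
  have hpair : ∀ t p, g t p = p ∨ g t p = !₂[p 0, p 1, -p 2] := fun t p => by
    obtain ⟨h1, h2⟩ := hco t p
    have e := congrArg (· ^ 2) ((g t).dist_eq p (sidePoint √(1 - c)))
    simp only [hside, dist_sq_eq] at e
    simp [sidePoint, h1] at e
    have h0 : g t p 0 = p 0 := by
      have h4 : (2 + √(1 - c) - 1 / 6) * (g t p 0 - p 0) = 0 := by
        linear_combination (h2 - e) / 2
      rcases mul_eq_zero.1 h4 with h4 | h4 <;> linarith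
    rw [h0] at h2
    rcases sq_eq_sq_iff_eq_or_eq_neg.1 (add_left_cancel h2) with h2 | h2
    · exact Or.inl (E3.ext h0 h1 h2)
    · exact Or.inr (E3.ext h0 h1 h2)
  obtain ⟨t, p, hne⟩ := hg.nontrivial
  refine hne ?_
  rw [half]
  refine (apply_apply_eq_of_mapsTo_pair (b := !₂[p 0, p 1, -p 2]) (g (t / 2)).injective
    (hpair _ p) ?_).1
  rcases hpair (t / 2) !₂[p 0, p 1, -p 2] with h | h
  · exact Or.inr h
  · refine Or.inl (h.trans (E3.ext rfl rfl ?_))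
    simp

theorem theorem1 :
    ∃ (Ω : Set E3) (Pb : ℝ) (u : E3 → E3) (P : E3 → ℝ),
      IsToroidalDomain Ω ∧
      IsSmoothSolution Ω Pb u P ∧
      (∃ x ∈ Ω, LinearIndependent ℝ ![curl u x, u x]) ∧
      (∀ c : ℝ, (levelSet Ω P c).Nonempty →
        ¬ HasContinuousEuclideanSymmetry (levelSet Ω P c)) ∧
      (∀ a b : E3, (a ≠ 0 ∨ b ≠ 0) → ∃ x ∈ Ω, inner ℝ (a + cross b x) (gradient P x) ≠ 0) ∧
      (∃ r₀ Ψ₀ ε : ℝ, 0 < r₀ ∧ 0 < Ψ₀ ∧ 0 < ε ∧ Pb < Ψ₀ ∧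
        IsToroidalMapPair r₀ Ψ₀ ε Pb Ω u P) :=
  ⟨warpedTorus, 0, velocityField, pressureField, isToroidalDomain_warpedTorus,
    isSmoothSolution_warpedTorus, exists_linearIndependent_curl,
    not_hasContinuousEuclideanSymmetry_levelSet,
    fun _ _ => exists_inner_killing_gradient_ne_zero,
    2, 1, 1 / 4, by norm_num, by norm_num, by norm_num, by norm_num,
    isToroidalMapPair_warpedTorus⟩
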